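/- Let $b,\gamma:[0,\infty)\to(0,1]$ be continuous functions with $b+\gamma\le 1$, and let $\beta$ be a probability density on $[0,\infty)$ with support $(0,a+1)$, $a\le\infty$ (that is, $\beta>0$ almost everywhere on $(0,a+1)$ and $\beta=0$ almost everywhere outside it). Let $(X_n)_{n\ge0}$ be the Markov chain on $[0,\infty)$ with one-step transition kernel $$P(x,\mathrm dy)=\begin{cases}\beta(y)\,\mathrm dy,&x=0,\\ \gamma(x)\delta_{0}(\mathrm dy)+b(x)\delta_{x+1}(\mathrm dy)+(1-\gamma(x)-b(x))\delta_{x}(\mathrm dy),&x>0.\end{cases}$$ A non-trivial $\sigma$-finite measure $\varphi$ is called an irreducibility measure if $\sum_{n\ge1}P^n(x,A)>0$ for all $x$ whenever $\varphi(A)>0$; let $\psi$ be a maximal irreducibility measure, i.e. one with $\varphi\ll\psi$ for every irreducibility measure $\varphi$, and let $\mathscr B^+$ be the class of measurable sets $A$ with $\psi(A)>0$ (it does not depend on the choice of $\psi$). The chain is recurrent if $\sum_{n\ge1}P^n(x,A)=\infty$ for all $x$ and all $A\in\mathscr B^+$, and transient otherwise; it is Harris recurrent if $\mathbb P_x\left(\sum_{n\ge1}\mathbf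 1_{\{X_n\in A\}}=\infty\right)=1$ for all $x$ and all $A\in\mathscr B^+$. Then a maximal irreducibility measure exists whenever one of the following two conditions holds, and: (1) If there is $x_1>0$ such that $b(x)>0$ for all $x\ge x_1$ and $$\prod_{m=\lfloor x_1\rfloor}^{\infty}\ \inf_{m\le x<m+1}\frac{b(x)+\gamma(x)}{b(x)}=\infty,$$ then $(X_n)$ is Harris recurrent, and in particular recurrent. (2) If there is $x_1>0$ such that $b(x)>0$ for all $x\ge x_1$ and $$\prod_{m=\lfloor x_1\rfloor}^{\infty}\ \sup_{m\le x<m+1}\frac{b(x)+\gamma(x)}{b(x)}<\infty,$$ then $(X_n)$ is transient. (The infinite products are limits of partial products. The condition $b(x)>0$ for $x\ge x_1$ is automatic here, since $b>0$ everywhere.) -/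

import Mathlib

open MeasureTheory ProbabilityTheory Filter Topology Set
open scoped NNReal ENNReal

noncomputable section

namespace MarkovChain

variable {α : Type*} [MeasurableSpace α]

/-- `ψ` is an irreducibility measure of the chain with one-step kernel `P`: it is non-trivial,
σ-finite, and every set it charges is reached, in at least one step and with positive
probability, from every starting point. -/
structure IsIrreducibilityMeasure (P : Kernel α α) (ψ : Measure α) : Prop where
  sigmaFinite : SigmaFinite ψ
  ne_zero : ψ ≠ 0
  pos : ∀ A, MeasurableSet A → 0 < ψ A → ∀ x, 0 < ∑' n : ℕ, (P ^ (n + 1)) x A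

/-- A maximal irreducibility measure: one that dominates all the others. -/
structure IsMaximalIrreducibilityMeasure (P : Kernel α α) (ψ : Measure α) : Prop
    extends IsIrreducibilityMeasure P ψ where
  maximal : ∀ φ : Measure α, IsIrreducibilityMeasure P φ → φ ≪ ψ

/-- The class of measurable sets charged by a (hence every) maximal irreducibility measure. -/
def PositiveSets (ψ : Measure α) : Set (Set α) := {A | MeasurableSet A ∧ 0 < ψ A}

/-- Recurrence of a `ψ`-irreducible chain: `∑_{n ≥ 1} P^n(x, A) = ∞` for all `x` and all
positive sets `A`. Maximal irreducibility measures are mutually absolutely continuous, so it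
does not matter which of them is used; that one exists is part of the definition. -/
def IsRecurrent (P : Kernel α α) : Prop :=
  (∃ ψ, IsMaximalIrreducibilityMeasure P ψ) ∧
    ∀ ψ, IsMaximalIrreducibilityMeasure P ψ →
      ∀ x, ∀ A ∈ PositiveSets ψ, ∑' n : ℕ, (P ^ (n + 1)) x A = ∞

/-- Transience of a `ψ`-irreducible chain: the chain is `ψ`-irreducible and not recurrent. -/
def IsTransient (P : Kernel α α) : Prop :=
  (∃ ψ, IsMaximalIrreducibilityMeasure P ψ) ∧ ¬ IsRecurrent P

/-- The law on the path space `ℕ → α` of the homogeneous Markov chain with one-step kernel `P`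
started at `x` (Ionescu-Tulcea; the step from time `n` to `n + 1` only uses the state at
time `n`). -/
def pathLaw (P : Kernel α α) [IsMarkovKernel P] (x : α) : Measure (ℕ → α) :=
  Kernel.traj (X := fun _ : ℕ => α)
    (fun n => P.comap (fun h : (i : Finset.Iic n) → α => h ⟨n, Finset.mem_Iic.2 le_rfl⟩)
      (measurable_pi_apply _)) 0 (fun _ => x)

/-- Harris recurrence of a `ψ`-irreducible chain: from every starting point, every positive set
is visited infinitely often with probability one. -/
def IsHarrisRecurrent (P : Kernel α α) [IsMarkovKernel P] : Prop :=
  (∃ ψ, IsMaximalIrreducibilityMeasure P ψ) ∧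
    ∀ ψ, IsMaximalIrreducibilityMeasure P ψ → ∀ x, ∀ A ∈ PositiveSets ψ,
      ∀ᵐ ω ∂(pathLaw P x), ∑' n : ℕ, A.indicator (1 : α → ℝ≥0∞) (ω (n + 1)) = ∞

end MarkovChain

/-- Lebesgue measure on `ℝ⁺ = [0, ∞)`. -/
def lebesgue : Measure ℝ≥0 := (volume : Measure ℝ).comap (fun x : ℝ≥0 => (x : ℝ))

/-- The data of the chain on `ℝ⁺ = [0, ∞)`: continuous functions `b, γ : ℝ⁺ → (0, 1]` with
`b + γ ≤ 1`, and a probability density `β` on `ℝ⁺` with support `(0, a + 1)`, `a ≤ ∞`. -/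
structure ImmigrationChain where
  b : ℝ≥0 → ℝ
  γ : ℝ≥0 → ℝ
  β : ℝ≥0 → ℝ
  a : EReal
  continuous_b : Continuous b
  continuous_γ : Continuous γ
  b_pos : ∀ x, 0 < b x
  γ_pos : ∀ x, 0 < γ x
  b_add_γ_le : ∀ x, b x + γ x ≤ 1
  measurable_β : Measurable β
  β_nonneg : ∀ x, 0 ≤ β x
  lintegral_β : ∫⁻ x, ENNReal.ofReal (β x) ∂lebesgue = 1
  support_β : ∀ᵐ x ∂lebesgue, β x ≠ 0 ↔ 0 < x ∧ ((x : ℝ) : EReal) < a + 1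

namespace ImmigrationChain

variable (M : ImmigrationChain)

/-- The one-step transition kernel: from `0` the chain jumps according to the density `β`; from
`x > 0` it jumps to `0` with probability `γ x`, to `x + 1` with probability `b x`, and stays at
`x` with the remaining probability. -/
def kernel : Kernel ℝ≥0 ℝ≥0 where
  toFun x :=
    if x = 0 then lebesgue.withDensity (fun y => ENNReal.ofReal (M.β y))
    else ENNReal.ofReal (M.γ x) • Measure.dirac 0 + ENNReal.ofReal (M.b x) • Measure.dirac (x + 1)
      + ENNReal.ofReal (1 - M.γ x - M.b x) • Measure.dirac x
  measurable' := by
    have hb := M.continuous_b.measurable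
    have hγ := M.continuous_γ.measurable
    refine Measurable.ite (measurableSet_singleton 0) measurable_const ?_
    refine Measure.measurable_of_measurable_coe _ fun s hs => ?_
    simp only [Measure.add_apply, Measure.smul_apply, smul_eq_mul, Measure.dirac_apply' _ hs]
    have h1 : Measurable (s.indicator (1 : ℝ≥0 → ℝ≥0∞)) := measurable_one.indicator hs
    have h2 : Measurable fun x : ℝ≥0 => s.indicator (1 : ℝ≥0 → ℝ≥0∞) (x + 1) :=
      h1.comp (measurable_id.add_const 1)
    fun_prop

instance : IsMarkovKernel M.kernel where
  isProbabilityMeasure x := by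
    constructor
    show (if x = 0 then _ else _ : Measure ℝ≥0) univ = 1
    split_ifs
    · simpa using M.lintegral_β
    · have h1 := (M.b_pos x).le
      have h2 := (M.γ_pos x).le
      have h3 := M.b_add_γ_le x
      simp only [Measure.add_apply, Measure.smul_apply, smul_eq_mul, measure_univ, mul_one]
      rw [← ENNReal.ofReal_add h2 h1, ← ENNReal.ofReal_add (by linarith) (by linarith)]
      simp

/-- The ratio `(b + γ) / b`. -/
def ratio (x : ℝ≥0) : ℝ := (M.b x + M.γ x) / M.b x

/-- `inf_{m ≤ x < m + 1} (b(x) + γ(x)) / b(x)`. -/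
def infRatio (m : ℕ) : ℝ := sInf (M.ratio '' Ico (m : ℝ≥0) (m + 1))

/-- `sup_{m ≤ x < m + 1} (b(x) + γ(x)) / b(x)`. -/
def supRatio (m : ℕ) : ℝ := sSup (M.ratio '' Ico (m : ℝ≥0) (m + 1))

end ImmigrationChain

end

/-! The point `0` is an accessible atom: every `x > 0` jumps there with probability `γ x > 0`, and
`β` has no mass at `0`. The occupation measure of the chain started at `0` is therefore, up to
equivalence, a maximal irreducibility measure, and it charges `{0}`.

The reciprocal of `ratio x` is the probability that the jump out of `x`, when it finally occurs,
goes up. So the reciprocal products along `x, x + 1, …` govern whether the chain can climb forever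
without returning to `0`.

Case (1): for a positive set `A`, the probability `u` of never hitting `A` is subharmonic and
bounded by `1`. Subharmonicity at `x > 0` makes the excess over `u 0` grow by the factor `ratio x`
from `x` to `x + 1`; since the products diverge, a positive excess would be unbounded, so `u` is
maximal at `0` (`le_apply_zero_of_subharmonic`). As `A` is accessible from `0`, a maximum principle
forces `u = 0` (`neverProb_eq_zero`), and the Markov property turns this into infinitely many visits
(`ae_tsum_eq_top`).

Case (2): the products are bounded uniformly in the starting point, so the escape probability is
bounded below. Set to `0` at the atom, it is a bounded function whose expectation rises by a fixed
amount at each visit to `0`. Hence the expected number of returns to `0` is finite although `{0}` is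
a positive set. -/

namespace MarkovChain

/-! ### Kernel powers, accessible atoms and avoidance probabilities -/

section Kernel

variable {α : Type*} [MeasurableSpace α] (P : Kernel α α)

theorem lintegral_pow_succ (n : ℕ) (x : α) {f : α → ℝ≥0∞} (hf : Measurable f) :
    ∫⁻ y, f y ∂(P ^ (n + 1)) x = ∫⁻ y, ∫⁻ z, f z ∂(P y) ∂(P ^ n) x := by
  rw [pow_succ']
  exact Kernel.lintegral_comp _ _ _ hf

theorem lintegral_pow_zero (x : α) {f : α → ℝ≥0∞} (hf : Measurable f) :
    ∫⁻ y, f y ∂(P ^ 0) x = f x := by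
  rw [pow_zero]
  exact Kernel.lintegral_id' hf x

theorem pow_apply_univ [IsMarkovKernel P] (n : ℕ) (x : α) : (P ^ n) x univ = 1 := by
  induction n with
  | zero => simpa using lintegral_pow_zero P x (measurable_one (α := ℝ≥0∞))
  | succ n ih => simpa [ih] using lintegral_pow_succ P n x (measurable_one (α := ℝ≥0∞))

theorem le_lintegral_pow {f : α → ℝ≥0∞} (hf : Measurable f)
    (h : ∀ x, f x ≤ ∫⁻ y, f y ∂(P x)) (n : ℕ) (x : α) : f x ≤ ∫⁻ y, f y ∂(P ^ n) x := by
  induction n with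
  | zero => rw [lintegral_pow_zero P x hf]
  | succ n ih =>
    rw [lintegral_pow_succ P n x hf]
    exact ih.trans (lintegral_mono h)

theorem pow_mul_pow_le_pow_add (m n : ℕ) (x a : α) (ha : MeasurableSet {a}) {A : Set α}
    (hA : MeasurableSet A) : (P ^ n) a A * (P ^ m) x {a} ≤ (P ^ (m + n)) x A := by
  rw [Kernel.pow_add_apply_eq_lintegral P m n x hA]
  calc (P ^ n) a A * (P ^ m) x {a} = ∫⁻ y in {a}, (P ^ n) a A ∂(P ^ m) x := by simp
    _ = ∫⁻ y in {a}, (P ^ n) y A ∂(P ^ m) x :=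
        setLIntegral_congr_fun ha fun y hy => by rw [mem_singleton_iff.1 hy]
    _ ≤ _ := setLIntegral_le_lintegral _ _

/-- An accessible atom yields a maximal irreducibility measure that charges it. -/
theorem exists_isMaximalIrreducibilityMeasure [IsMarkovKernel P] (a : α)
    (ha : MeasurableSet {a}) (h : ∀ x, 0 < ∑' n : ℕ, (P ^ (n + 1)) x {a}) :
    ∃ ψ, IsMaximalIrreducibilityMeasure P ψ ∧ 0 < ψ {a} := by
  have : ∀ n : ℕ, IsFiniteMeasure ((P ^ (n + 1)) a) := fun n =>
    ⟨by rw [pow_apply_univ]; exact ENNReal.one_lt_top⟩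
  -- The occupation measure from `a` need not be σ-finite; `toFinite` replaces it by an equivalent
  -- finite measure.
  set μ := Measure.sum fun n : ℕ => (P ^ (n + 1)) a with hμ
  have hμA : ∀ A, MeasurableSet A → μ A = ∑' n : ℕ, (P ^ (n + 1)) a A := fun A hA => by
    rw [hμ, Measure.sum_apply _ hA]
  have hpos : 0 < μ.toFinite {a} := by
    refine pos_iff_ne_zero.2 fun h0 => (h a).ne' ?_
    rw [← hμA _ ha]
    exact (absolutelyContinuous_toFinite μ) h0
  refine ⟨μ.toFinite, ⟨⟨inferInstance, ?_, ?_⟩, ?_⟩, hpos⟩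
  · intro h0
    simp [h0] at hpos
  · intro A hA hA0 x
    have h1 : ∑' n : ℕ, (P ^ (n + 1)) a A ≠ 0 := by
      rw [← hμA A hA]
      exact fun h0 => hA0.ne' (toFinite_absolutelyContinuous μ h0)
    obtain ⟨n, hn⟩ := not_forall.1 (mt ENNReal.tsum_eq_zero.2 h1)
    obtain ⟨m, hm⟩ := not_forall.1 (mt ENNReal.tsum_eq_zero.2 (h x).ne')
    -- Go from `x` to `a` in `m + 1` steps, then from `a` into `A` in `n + 1` steps.
    refine lt_of_lt_of_le ?_ (ENNReal.le_tsum (m + 1 + n))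
    exact (pos_iff_ne_zero.2 (mul_ne_zero hn hm)).trans_le
      (pow_mul_pow_le_pow_add P (m + 1) (n + 1) x a ha hA)
  · intro φ hφ
    refine Measure.AbsolutelyContinuous.mk fun A hA hA0 => ?_
    by_contra hne
    have := hφ.pos A hA (pos_iff_ne_zero.2 hne) a
    rw [← hμA A hA] at this
    exact this.ne' (absolutelyContinuous_toFinite μ hA0)

variable {A : Set α}

/-- The probability that the chain started at `x` avoids `A` at the times `1, …, k`. -/
noncomputable def avoidProb (A : Set α) : ℕ → α → ℝ≥0∞
  | 0 => 1
  | k + 1 => fun x => ∫⁻ y in Aᶜ, avoidProb A k y ∂(P x)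

/-- The probability that the chain started at `x` avoids `A` at all positive times. -/
noncomputable def neverProb (A : Set α) (x : α) : ℝ≥0∞ := ⨅ k, avoidProb P A k x

theorem neverProb_le_one (A : Set α) (x : α) : neverProb P A x ≤ 1 := iInf_le _ 0

variable [IsMarkovKernel P]

theorem measurable_avoidProb (hA : MeasurableSet A) (k : ℕ) : Measurable (avoidProb P A k) := by
  induction k with
  | zero => exact measurable_one
  | succ k ih => exact ih.setLIntegral_kernel hA.compl

theorem avoidProb_succ_le (A : Set α) (k : ℕ) : avoidProb P A (k + 1) ≤ avoidProb P A k := by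
  induction k with
  | zero =>
    intro x
    simpa [avoidProb] using prob_le_one
  | succ k ih => exact fun x => lintegral_mono ih

theorem antitone_avoidProb (A : Set α) : Antitone (avoidProb P A) :=
  antitone_nat_of_succ_le (avoidProb_succ_le P A)

theorem measurable_neverProb (hA : MeasurableSet A) : Measurable (neverProb P A) :=
  Measurable.iInf fun k => measurable_avoidProb P hA k

/-- First-step analysis: the infimum over horizons passes through the integral by decreasing
convergence. In particular `neverProb` is subharmonic. -/
theorem neverProb_le (hA : MeasurableSet A) (x : α) :
    neverProb P A x ≤ ∫⁻ y in Aᶜ, neverProb P A y ∂(P x) := by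
  unfold neverProb
  rw [lintegral_iInf (measurable_avoidProb P hA) (antitone_avoidProb P A)]
  · exact le_iInf fun k => iInf_le _ (k + 1)
  · exact ne_top_of_le_ne_top ENNReal.one_ne_top (avoidProb_succ_le P A 0 x)

/-- If the probability of never hitting `A` is maximal at `a`, and `A` is accessible from `a`,
then `A` is hit almost surely from every starting point. -/
theorem neverProb_eq_zero (hA : MeasurableSet A) (a : α)
    (hmax : ∀ x, neverProb P A x ≤ neverProb P A a)
    (ha : 0 < ∑' n : ℕ, (P ^ (n + 1)) a A) (x : α) : neverProb P A x = 0 := by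
  obtain ⟨n, hn⟩ := not_forall.1 (mt ENNReal.tsum_eq_zero.2 ha.ne')
  have hm := measurable_neverProb P hA
  have hfin : neverProb P A a ≠ ∞ := ne_top_of_le_ne_top ENNReal.one_ne_top
    (neverProb_le_one P A a)
  have hle : ∀ x, neverProb P A x ≤ ∫⁻ y, neverProb P A y ∂(P x) := fun x =>
    (neverProb_le P hA x).trans (setLIntegral_le_lintegral _ _)
  -- Subharmonicity is used for `n` steps and the sharper bound, restricted to `Aᶜ`, for the last
  -- one; maximality at `a` then bounds the integrand.
  have key : neverProb P A a ≤ neverProb P A a * (P ^ (n + 1)) a Aᶜ := by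
    calc neverProb P A a ≤ ∫⁻ y, neverProb P A y ∂(P ^ n) a := le_lintegral_pow P hm hle n a
      _ ≤ ∫⁻ y, ∫⁻ z, Aᶜ.indicator (neverProb P A) z ∂(P y) ∂(P ^ n) a := by
          refine lintegral_mono fun y => ?_
          rw [lintegral_indicator hA.compl]
          exact neverProb_le P hA y
      _ = ∫⁻ z in Aᶜ, neverProb P A z ∂(P ^ (n + 1)) a := by
          rw [← lintegral_pow_succ P n a (hm.indicator hA.compl), lintegral_indicator hA.compl]
      _ ≤ ∫⁻ z in Aᶜ, neverProb P A a ∂(P ^ (n + 1)) a := lintegral_mono hmax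
      _ = _ := by simp
  have hsum : (P ^ (n + 1)) a A + (P ^ (n + 1)) a Aᶜ = 1 := by
    rw [measure_add_measure_compl hA, pow_apply_univ]
  have hz : neverProb P A a = 0 := by
    have h2 : neverProb P A a * (P ^ (n + 1)) a A + neverProb P A a
        ≤ 0 + neverProb P A a := by
      calc _ ≤ neverProb P A a * (P ^ (n + 1)) a A
            + neverProb P A a * (P ^ (n + 1)) a Aᶜ := by gcongr
        _ = 0 + neverProb P A a := by rw [← mul_add, hsum, mul_one, zero_add]
    have h3 := (ENNReal.add_le_add_iff_right hfin).1 h2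
    exact (mul_eq_zero.1 (le_zero_iff.1 h3)).resolve_right hn
  exact le_zero_iff.1 (hz ▸ hmax x)

end Kernel

/-! ### The path law, its Markov property and infinitely many visits -/

section Path

/-- The paths that avoid `A` at the times `n + 1, …, n + k`. -/
def avoidPaths {α : Type*} (A : Set α) (n k : ℕ) : Set (ℕ → α) :=
  {ω | ∀ j, n < j → j ≤ n + k → ω j ∉ A}

theorem avoidPaths_succ {α : Type*} (A : Set α) (n k : ℕ) :
    avoidPaths A n (k + 1) = avoidPaths A n k ∩ {ω | ω (n + k + 1) ∉ A} := by
  ext ω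
  simp only [avoidPaths, mem_ofPred_eq, mem_inter_iff]
  constructor
  · exact fun h => ⟨fun j h1 h2 => h j h1 (by omega), h _ (by omega) (by omega)⟩
  · rintro ⟨h1, h2⟩ j h3 h4
    rcases (show j ≤ n + k ∨ j = n + k + 1 by omega) with h | rfl
    exacts [h1 j h3 h, h2]

variable {α : Type*} [MeasurableSpace α] (P : Kernel α α) [IsMarkovKernel P]

instance (x : α) : IsProbabilityMeasure (pathLaw P x) := by
  unfold pathLaw
  infer_instance

/-- The Markov property for one step, on events determined by the first `n` steps. -/
theorem setLIntegral_pathLaw_succ (x : α) (n : ℕ) {S : Set ((i : Finset.Iic n) → α)}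
    (hS : MeasurableSet S) {f : α → ℝ≥0∞} (hf : Measurable f) :
    ∫⁻ ω in Preorder.frestrictLe n ⁻¹' S, f (ω (n + 1)) ∂(pathLaw P x)
      = ∫⁻ ω in Preorder.frestrictLe n ⁻¹' S, ∫⁻ y, f y ∂(P (ω n)) ∂(pathLaw P x) := by
  let κ : (n : ℕ) → Kernel ((i : Finset.Iic n) → α) α := fun n =>
    P.comap (fun h : (i : Finset.Iic n) → α => h ⟨n, Finset.mem_Iic.2 le_rfl⟩)
      (measurable_pi_apply _)
  have hκ : ∀ n, IsMarkovKernel (κ n) := fun n => inferInstanceAs (IsMarkovKernel (P.comap _ _))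
  let x₀ : (i : Finset.Iic 0) → α := fun _ => x
  have hpath : pathLaw P x = Kernel.traj (X := fun _ : ℕ => α) κ 0 x₀ := rfl
  have hcomp := Kernel.partialTraj_compProd_eq_map_traj (X := fun _ : ℕ => α) (κ := κ)
    (Nat.zero_le n) (x₀ := x₀)
  have hmap := Kernel.traj_map_frestrictLe_apply (X := fun _ : ℕ => α) (κ := κ) 0 n x₀
  have hg : Measurable fun p : ((i : Finset.Iic n) → α) × α => S.indicator 1 p.1 * f p.2 :=
    ((measurable_one.indicator hS).comp measurable_fst).mul (hf.comp measurable_snd)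
  have hSm : MeasurableSet (Preorder.frestrictLe (π := fun _ : ℕ => α) n ⁻¹' S) :=
    Preorder.measurable_frestrictLe n hS
  have hPf : Measurable fun z => ∫⁻ y, f y ∂(P z) := hf.lintegral_kernel
  -- The joint law of the history up to `n` and the state at `n + 1` is a composition product; test
  -- it on the indicator of `S` times `f`.
  have h1 := congrArg (fun μ => ∫⁻ p, S.indicator 1 p.1 * f p.2 ∂μ) hcomp
  rw [lintegral_map hg (by fun_prop), Measure.lintegral_compProd hg, ← hmap,
    lintegral_map (hg.lintegral_kernel_prod_right') (by fun_prop)] at h1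
  rw [hpath, ← lintegral_indicator hSm, ← lintegral_indicator hSm]
  refine Eq.trans ?_ (h1.symm.trans ?_)
  · refine lintegral_congr fun ω => ?_
    by_cases hω : Preorder.frestrictLe n ω ∈ S <;> simp [hω]
  · refine lintegral_congr fun ω => ?_
    by_cases hω : Preorder.frestrictLe n ω ∈ S <;> simp [hω, κ]

theorem lintegral_pathLaw_zero (x : α) {f : α → ℝ≥0∞} (hf : Measurable f) :
    ∫⁻ ω, f (ω 0) ∂(pathLaw P x) = f x := by
  let κ : (n : ℕ) → Kernel ((i : Finset.Iic n) → α) α := fun n =>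
    P.comap (fun h : (i : Finset.Iic n) → α => h ⟨n, Finset.mem_Iic.2 le_rfl⟩)
      (measurable_pi_apply _)
  have hκ : ∀ n, IsMarkovKernel (κ n) := fun n => inferInstanceAs (IsMarkovKernel (P.comap _ _))
  have hmap := Kernel.traj_map_frestrictLe_apply (X := fun _ : ℕ => α) (κ := κ) 0 0 (fun _ => x)
  have hg : Measurable fun h : (i : Finset.Iic 0) → α => f (h ⟨0, Finset.mem_Iic.2 le_rfl⟩) :=
    hf.comp (measurable_pi_apply _)
  have h1 := congrArg (fun μ => ∫⁻ h, f (h ⟨0, Finset.mem_Iic.2 le_rfl⟩) ∂μ) hmap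
  rw [lintegral_map hg (by fun_prop), Kernel.partialTraj_self, Kernel.lintegral_id' hg] at h1
  exact h1

theorem lintegral_pathLaw (x : α) (n : ℕ) {f : α → ℝ≥0∞} (hf : Measurable f) :
    ∫⁻ ω, f (ω n) ∂(pathLaw P x) = ∫⁻ y, f y ∂(P ^ n) x := by
  induction n generalizing f with
  | zero => rw [lintegral_pathLaw_zero P x hf, lintegral_pow_zero P x hf]
  | succ n ih =>
    have := setLIntegral_pathLaw_succ P x n MeasurableSet.univ hf
    simp only [preimage_univ, Measure.restrict_univ] at this
    rw [this, ih (f := fun z => ∫⁻ y, f y ∂(P z)) hf.lintegral_kernel, lintegral_pow_succ P n x hf]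

variable {A : Set α}

theorem exists_avoidPaths_eq_preimage (hA : MeasurableSet A) (n k : ℕ) :
    ∃ S : Set ((i : Finset.Iic (n + k)) → α), MeasurableSet S ∧
      avoidPaths A n k = Preorder.frestrictLe (n + k) ⁻¹' S := by
  refine ⟨⋂ j : Finset.Iic (n + k), ⋂ _ : n < (j : ℕ), (fun h => h j) ⁻¹' Aᶜ, ?_, ?_⟩
  · exact .iInter fun j => .iInter fun _ => measurable_pi_apply j hA.compl
  · ext ω
    simp only [avoidPaths, mem_ofPred_eq, mem_preimage, mem_iInter, Subtype.forall,
      Finset.mem_Iic, mem_compl_iff, Preorder.frestrictLe_apply]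
    exact forall_congr' fun j => ⟨fun h a b => h b a, fun h a b => h b a⟩

/-- Each use of the Markov property trades the last avoided time on the path for one more step of
`avoidProb`; `m` must vary in the induction. -/
theorem setLIntegral_avoidPaths (hA : MeasurableSet A) (x : α) (n k m : ℕ) :
    ∫⁻ ω in avoidPaths A n k, avoidProb P A m (ω (n + k)) ∂(pathLaw P x)
      = ∫⁻ ω, avoidProb P A (m + k) (ω n) ∂(pathLaw P x) := by
  induction k generalizing m with
  | zero =>
    have : avoidPaths A n 0 = univ := by
      ext ω
      simp only [avoidPaths, mem_ofPred_eq, mem_univ, iff_true]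
      intro j h1 h2
      omega
    simp [this]
  | succ k ih =>
    obtain ⟨S, hS, hSe⟩ := exists_avoidPaths_eq_preimage hA n k
    have hAm : MeasurableSet {ω : ℕ → α | ω (n + k + 1) ∈ A} := measurable_pi_apply _ hA
    have hm := measurable_avoidProb P hA m
    calc ∫⁻ ω in avoidPaths A n (k + 1), avoidProb P A m (ω (n + k + 1)) ∂(pathLaw P x)
        = ∫⁻ ω in avoidPaths A n k,
            Aᶜ.indicator (avoidProb P A m) (ω (n + k + 1)) ∂(pathLaw P x) := by
          rw [avoidPaths_succ, inter_comm]
          exact (setLIntegral_indicator hAm.compl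
            fun ω : ℕ → α => avoidProb P A m (ω (n + k + 1))).symm
      _ = ∫⁻ ω in avoidPaths A n k, avoidProb P A (m + 1) (ω (n + k)) ∂(pathLaw P x) := by
          rw [hSe, setLIntegral_pathLaw_succ P x (n + k) hS (hm.indicator hA.compl)]
          simp only [lintegral_indicator hA.compl, avoidProb]
      _ = _ := by rw [ih, show m + 1 + k = m + (k + 1) by omega]

theorem pathLaw_avoidPaths (hA : MeasurableSet A) (x : α) (n k : ℕ) :
    pathLaw P x (avoidPaths A n k) = ∫⁻ ω, avoidProb P A k (ω n) ∂(pathLaw P x) := by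
  simpa [avoidProb] using setLIntegral_avoidPaths P hA x n k 0

/-- A set that is almost surely hit from everywhere is almost surely visited infinitely often. -/
theorem ae_tsum_eq_top (hA : MeasurableSet A) (h : ∀ x, neverProb P A x = 0) (x : α) :
    ∀ᵐ ω ∂(pathLaw P x), ∑' n : ℕ, A.indicator (1 : α → ℝ≥0∞) (ω (n + 1)) = ∞ := by
  have hev : ∀ n, pathLaw P x (⋂ k, avoidPaths A n k) = 0 := fun n => by
    refine le_zero_iff.1 ?_
    calc pathLaw P x (⋂ k, avoidPaths A n k)
        ≤ ⨅ k, ∫⁻ ω, avoidProb P A k (ω n) ∂(pathLaw P x) :=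
          le_iInf fun k => (measure_mono (iInter_subset _ k)).trans_eq
            (pathLaw_avoidPaths P hA x n k)
      _ = ∫⁻ ω, neverProb P A (ω n) ∂(pathLaw P x) := by
          refine (lintegral_iInf (f := fun k (ω : ℕ → α) => avoidProb P A k (ω n))
            (fun k => (measurable_avoidProb P hA k).comp (measurable_pi_apply n))
            (fun i j hij ω => antitone_avoidProb P A hij (ω n)) ?_).symm
          simp [avoidProb]
      _ = 0 := by simp [h]
  have hall : ∀ᵐ ω ∂(pathLaw P x), ∀ n, ω ∉ ⋂ k, avoidPaths A n k :=
    ae_all_iff.2 fun n => measure_eq_zero_iff_ae_notMem.1 (hev n)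
  filter_upwards [hall] with ω hω
  by_contra hne
  have hfin := ENNReal.tendsto_cofinite_zero_of_tsum_ne_top hne
  -- A finite sum of indicators has terms eventually below `1`, so the path avoids `A` from some
  -- time on.
  rw [Nat.cofinite_eq_atTop] at hfin
  obtain ⟨n, hn⟩ := eventually_atTop.1 (hfin.eventually_lt_const one_pos)
  refine hω n (mem_iInter.2 fun k j hj _ hjA => ?_)
  have := hn (j - 1) (by omega)
  rw [Nat.sub_add_cancel (by omega)] at this
  simp [hjA] at this

/-- By Tonelli the sum is the expected number of visits, and that number is almost surely infinite.
-/
theorem IsHarrisRecurrent.isRecurrent (h : IsHarrisRecurrent P) : IsRecurrent P := by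
  refine ⟨h.1, fun ψ hψ x A hA => ?_⟩
  have hm : Measurable (A.indicator (1 : α → ℝ≥0∞)) := measurable_one.indicator hA.1
  calc ∑' n : ℕ, (P ^ (n + 1)) x A
      = ∑' n : ℕ, ∫⁻ ω, A.indicator (1 : α → ℝ≥0∞) (ω (n + 1)) ∂(pathLaw P x) := by
        refine tsum_congr fun n => ?_
        rw [lintegral_pathLaw P x (n + 1) hm, lintegral_indicator_one hA.1]
    _ = ∫⁻ ω, ∑' n : ℕ, A.indicator (1 : α → ℝ≥0∞) (ω (n + 1)) ∂(pathLaw P x) :=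
        (lintegral_tsum fun n => (hm.comp (measurable_pi_apply _)).aemeasurable).symm
    _ = ∞ := by
        rw [lintegral_congr_ae (h.2 ψ hψ x A hA)]
        simp

end Path

end MarkovChain

/-! ### The atom `0` and the ratios along upward orbits -/

namespace ImmigrationChain

open MarkovChain

variable (M : ImmigrationChain)

theorem kernel_zero : M.kernel 0 = lebesgue.withDensity fun y => ENNReal.ofReal (M.β y) :=
  if_pos rfl

theorem kernel_of_ne_zero {x : ℝ≥0} (hx : x ≠ 0) :
    M.kernel x = ENNReal.ofReal (M.γ x) • Measure.dirac 0
      + ENNReal.ofReal (M.b x) • Measure.dirac (x + 1)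
      + ENNReal.ofReal (1 - M.γ x - M.b x) • Measure.dirac x :=
  if_neg hx

theorem lintegral_kernel_of_ne_zero {x : ℝ≥0} (hx : x ≠ 0) (f : ℝ≥0 → ℝ≥0∞) :
    ∫⁻ y, f y ∂(M.kernel x) = ENNReal.ofReal (M.γ x) * f 0 + ENNReal.ofReal (M.b x) * f (x + 1)
      + ENNReal.ofReal (1 - M.γ x - M.b x) * f x := by
  simp [M.kernel_of_ne_zero hx]

theorem kernel_zero_singleton_zero : M.kernel 0 {0} = 0 := by
  have h0 : lebesgue {(0 : ℝ≥0)} = 0 := by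
    have hcoe : MeasurableEmbedding ((↑) : ℝ≥0 → ℝ) :=
      NNReal.isClosedEmbedding_coe.measurableEmbedding
    rw [lebesgue, hcoe.comap_apply]
    simp
  rw [kernel_zero]
  exact withDensity_absolutelyContinuous _ _ h0

theorem kernel_singleton_zero_pos {x : ℝ≥0} (hx : x ≠ 0) : 0 < M.kernel x {0} := by
  rw [M.kernel_of_ne_zero hx]
  simp [hx, M.γ_pos x]

theorem accessible_zero (x : ℝ≥0) : 0 < ∑' n : ℕ, (M.kernel ^ (n + 1)) x {0} := by
  by_cases hx : x = 0
  · subst hx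
    refine lt_of_lt_of_le ?_ (ENNReal.le_tsum 1)
    rw [Kernel.pow_succ_apply_eq_lintegral _ _ _ (measurableSet_singleton 0), pow_one,
      lintegral_pos_iff_support (M.kernel.measurable_coe (measurableSet_singleton 0))]
    have h1 : M.kernel 0 {0}ᶜ = 1 := by
      rw [prob_compl_eq_one_iff (measurableSet_singleton 0), kernel_zero_singleton_zero]
    refine (h1 ▸ one_pos).trans_le (measure_mono fun y hy => ?_)
    exact (M.kernel_singleton_zero_pos hy).ne'
  · refine lt_of_lt_of_le ?_ (ENNReal.le_tsum 0)
    simpa using M.kernel_singleton_zero_pos hx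

theorem exists_maximal_charging_zero :
    ∃ ψ, IsMaximalIrreducibilityMeasure M.kernel ψ ∧ 0 < ψ {0} :=
  exists_isMaximalIrreducibilityMeasure M.kernel 0 (measurableSet_singleton 0) M.accessible_zero

theorem one_le_ratio (x : ℝ≥0) : 1 ≤ M.ratio x := by
  rw [ratio, one_le_div (M.b_pos x)]
  linarith [M.γ_pos x]

theorem ratio_pos (x : ℝ≥0) : 0 < M.ratio x := one_pos.trans_le (M.one_le_ratio x)

theorem b_mul_ratio (x : ℝ≥0) : M.b x * M.ratio x = M.b x + M.γ x :=
  mul_div_cancel₀ _ (M.b_pos x).ne'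

theorem continuous_ratio : Continuous M.ratio :=
  (M.continuous_b.add M.continuous_γ).div M.continuous_b fun x => (M.b_pos x).ne'

theorem one_le_infRatio (m : ℕ) : 1 ≤ M.infRatio m := by
  refine le_csInf (Nonempty.image _ ⟨(m : ℝ≥0), by simp⟩) ?_
  rintro _ ⟨x, -, rfl⟩
  exact M.one_le_ratio x

theorem add_natCast_mem_Ico (x : ℝ≥0) (k : ℕ) :
    x + k ∈ Ico ((⌊x⌋₊ + k : ℕ) : ℝ≥0) ((⌊x⌋₊ + k : ℕ) + 1) := by
  push_cast
  refine ⟨by gcongr; exact Nat.floor_le zero_le, ?_⟩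
  rw [add_right_comm]
  gcongr
  exact Nat.lt_floor_add_one x

theorem infRatio_le (x : ℝ≥0) (k : ℕ) : M.infRatio (⌊x⌋₊ + k) ≤ M.ratio (x + k) :=
  csInf_le ⟨1, by rintro _ ⟨x, -, rfl⟩; exact M.one_le_ratio x⟩
    (mem_image_of_mem _ (add_natCast_mem_Ico x k))

theorem bddAbove_ratio (m : ℕ) : BddAbove (M.ratio '' Ico (m : ℝ≥0) (m + 1)) :=
  (isCompact_Icc.bddAbove_image M.continuous_ratio.continuousOn).mono
    (image_mono Ico_subset_Icc_self)

theorem le_supRatio (x : ℝ≥0) (k : ℕ) : M.ratio (x + k) ≤ M.supRatio (⌊x⌋₊ + k) :=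
  le_csSup (M.bddAbove_ratio _) (mem_image_of_mem _ (add_natCast_mem_Ico x k))

theorem one_le_supRatio (m : ℕ) : 1 ≤ M.supRatio m :=
  (M.one_le_ratio m).trans (by simpa using M.le_supRatio m 0)

/-- The orbit `x, x + 1, …` has exactly one point in each unit interval from `⌊x⌋₊` on, and changing
finitely many positive factors does not affect divergence. -/
theorem tendsto_prod_ratio {N : ℕ}
    (h : Tendsto (fun n : ℕ => ∏ m ∈ Finset.Ico N n, M.infRatio m) atTop atTop) (x : ℝ≥0) :
    Tendsto (fun n : ℕ => ∏ k ∈ Finset.range n, M.ratio (x + k)) atTop atTop := by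
  have hpos : ∀ m, 0 < M.infRatio m := fun m => one_pos.trans_le (M.one_le_infRatio m)
  have hrange : Tendsto (fun n : ℕ => ∏ m ∈ Finset.range n, M.infRatio m) atTop atTop := by
    refine tendsto_atTop_mono (fun n => ?_) h
    refine Finset.prod_le_prod_of_subset_of_one_le ?_ ?_ ?_
    · intro m hm
      exact Finset.mem_range.2 (Finset.mem_Ico.1 hm).2
    · exact fun m _ => (hpos m).le
    · exact fun m _ _ => M.one_le_infRatio m
  have hC : 0 < ∏ m ∈ Finset.range ⌊x⌋₊, M.infRatio m := Finset.prod_pos fun m _ => hpos m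
  have hshift := (hrange.comp (tendsto_add_atTop_nat ⌊x⌋₊)).atTop_div_const hC
  refine tendsto_atTop_mono (fun n => ?_) hshift
  simp only [Function.comp_apply]
  rw [add_comm n, Finset.prod_range_add, mul_div_cancel_left₀ _ hC.ne']
  exact Finset.prod_le_prod (fun k _ => (hpos _).le) fun k _ => M.infRatio_le x k

/-- If the products of the ratios diverge, a bounded subharmonic function is maximal at `0`. -/
theorem le_apply_zero_of_subharmonic
    (hprod : ∀ x : ℝ≥0, Tendsto (fun n : ℕ => ∏ k ∈ Finset.range n, M.ratio (x + k)) atTop atTop)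
    {u : ℝ≥0 → ℝ≥0∞} (hu1 : ∀ x, u x ≤ 1) (hu : ∀ x, u x ≤ ∫⁻ y, u y ∂(M.kernel x)) (x : ℝ≥0) :
    u x ≤ u 0 := by
  have hfin : ∀ x, u x ≠ ∞ := fun x => ne_top_of_le_ne_top ENNReal.one_ne_top (hu1 x)
  set U : ℝ≥0 → ℝ := fun x => (u x).toReal with hU
  have huU : ∀ x, u x = ENNReal.ofReal (U x) := fun x => (ENNReal.ofReal_toReal (hfin x)).symm
  have hU0 : ∀ x, 0 ≤ U x := fun x => ENNReal.toReal_nonneg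
  have hU1 : ∀ x, U x ≤ 1 := fun x => by
    simpa using ENNReal.toReal_mono ENNReal.one_ne_top (hu1 x)
  -- Cancelling the holding term leaves `(b + γ) (U x - U 0) ≤ b (U (x + 1) - U 0)` at `x`; then
  -- divide by `b x`.
  have hstep : ∀ x, x ≠ 0 → (U x - U 0) * M.ratio x ≤ U (x + 1) - U 0 := by
    intro x hx
    have hb := M.b_pos x
    have hγ := M.γ_pos x
    have hbγ := M.b_add_γ_le x
    have h1 := hu x
    have e1 := mul_nonneg hγ.le (hU0 0)
    have e2 := mul_nonneg hb.le (hU0 (x + 1))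
    have e3 := mul_nonneg (show 0 ≤ 1 - M.γ x - M.b x by linarith) (hU0 x)
    rw [M.lintegral_kernel_of_ne_zero hx, huU x, huU 0, huU (x + 1), ← ENNReal.ofReal_mul hγ.le,
      ← ENNReal.ofReal_mul hb.le, ← ENNReal.ofReal_mul (by linarith), ← ENNReal.ofReal_add e1 e2,
      ← ENNReal.ofReal_add (by positivity) e3, ENNReal.ofReal_le_ofReal_iff (by positivity)] at h1
    refine le_of_mul_le_mul_left ?_ hb
    rw [mul_left_comm, M.b_mul_ratio]
    linarith
  have hiter : ∀ x, x ≠ 0 → ∀ n : ℕ,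
      (U x - U 0) * ∏ k ∈ Finset.range n, M.ratio (x + k) ≤ U (x + n) - U 0 := by
    intro x hx n
    induction n with
    | zero => simp
    | succ n ih =>
      have hxn : x + n ≠ 0 := fun h => hx (add_eq_zero.1 h).1
      rw [Finset.prod_range_succ, ← mul_assoc]
      calc _ ≤ (U (x + n) - U 0) * M.ratio (x + n) :=
            mul_le_mul_of_nonneg_right ih (M.ratio_pos _).le
        _ ≤ U (x + n + 1) - U 0 := hstep _ hxn
        _ = _ := by push_cast; rw [add_assoc]
  rw [huU x, huU 0]
  refine ENNReal.ofReal_le_ofReal ?_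
  by_contra! hlt
  have hx : x ≠ 0 := by
    rintro rfl
    exact lt_irrefl _ hlt
  obtain ⟨n, hn⟩ := (((hprod x).const_mul_atTop (sub_pos.2 hlt)).eventually_gt_atTop 1).exists
  linarith [hiter x hx n, hU1 (x + n), hU0 0]

theorem isHarrisRecurrent_of_tendsto
    (hprod : ∀ x : ℝ≥0, Tendsto (fun n : ℕ => ∏ k ∈ Finset.range n, M.ratio (x + k)) atTop atTop) :
    IsHarrisRecurrent M.kernel := by
  obtain ⟨ψ, hψ, -⟩ := M.exists_maximal_charging_zero
  refine ⟨⟨ψ, hψ⟩, fun φ hφ x A hA => ae_tsum_eq_top M.kernel hA.1 ?_ x⟩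
  refine neverProb_eq_zero M.kernel hA.1 0 ?_ (hφ.pos A hA.1 hA.2 0)
  refine M.le_apply_zero_of_subharmonic hprod (neverProb_le_one _ A) fun x => ?_
  exact (neverProb_le M.kernel hA.1 x).trans (setLIntegral_le_lintegral _ _)

/-! ### Escape probability and transience -/

/-- The probability that the jumps out of `x, x + 1, x + 2, …` all go upwards. -/
noncomputable def escapeProb (x : ℝ≥0) : ℝ≥0∞ :=
  ⨅ n : ℕ, ∏ k ∈ Finset.range n, ENNReal.ofReal (M.ratio (x + k))⁻¹

theorem measurable_escapeProb : Measurable M.escapeProb := by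
  have := M.continuous_ratio.measurable
  refine Measurable.iInf fun n => Finset.measurable_fun_prod _ fun k _ => ?_
  exact (this.comp (measurable_id.add_const _)).inv.ennreal_ofReal

theorem escapeProb_le_one (x : ℝ≥0) : M.escapeProb x ≤ 1 := iInf_le_of_le 0 (by simp)

theorem escapeProb_le_mul (x : ℝ≥0) :
    M.escapeProb x ≤ ENNReal.ofReal (M.ratio x)⁻¹ * M.escapeProb (x + 1) := by
  unfold escapeProb
  rw [ENNReal.mul_iInf_of_ne (by simpa using M.ratio_pos x) ENNReal.ofReal_ne_top]
  refine le_iInf fun n => iInf_le_of_le (n + 1) ?_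
  rw [Finset.prod_range_succ', mul_comm]
  simp [add_assoc, add_comm (1 : ℝ≥0)]

/-- The escape probability, with value `0` at the atom `0`, is subharmonic, strictly at `0`. -/
theorem escapeProb_add_le (x : ℝ≥0) :
    ({0}ᶜ : Set ℝ≥0).indicator M.escapeProb x
        + (∫⁻ y, ({0}ᶜ : Set ℝ≥0).indicator M.escapeProb y ∂(M.kernel 0)) *
          ({0} : Set ℝ≥0).indicator 1 x
      ≤ ∫⁻ y, ({0}ᶜ : Set ℝ≥0).indicator M.escapeProb y ∂(M.kernel x) := by
  by_cases hx : x = 0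
  · subst hx
    simp
  · have hx1 : x + 1 ≠ 0 := fun h => hx (add_eq_zero.1 h).1
    have hb := M.b_pos x
    have hγ := M.γ_pos x
    have hbγ := M.b_add_γ_le x
    have hup : ENNReal.ofReal (M.b x + M.γ x) * M.escapeProb x
        ≤ ENNReal.ofReal (M.b x) * M.escapeProb (x + 1) := by
      calc _ ≤ ENNReal.ofReal (M.b x + M.γ x) *
            (ENNReal.ofReal (M.ratio x)⁻¹ * M.escapeProb (x + 1)) := by
              gcongr
              exact M.escapeProb_le_mul x
        _ = _ := by
              rw [← mul_assoc, ← ENNReal.ofReal_mul (by positivity), ← M.b_mul_ratio,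
                mul_inv_cancel_right₀ (M.ratio_pos x).ne']
    rw [M.lintegral_kernel_of_ne_zero hx]
    simp only [mem_compl_iff, mem_singleton_iff, hx, hx1, not_false_eq_true, indicator_of_mem,
      indicator_of_notMem, not_true_eq_false, mul_zero, add_zero, zero_add]
    calc M.escapeProb x = ENNReal.ofReal (M.b x + M.γ x) * M.escapeProb x
          + ENNReal.ofReal (1 - M.γ x - M.b x) * M.escapeProb x := by
            rw [← add_mul, ← ENNReal.ofReal_add (by positivity) (by linarith)]
            simp [show M.b x + M.γ x + (1 - M.γ x - M.b x) = 1 by ring]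
      _ ≤ _ := by gcongr

/-- A drift argument: each visit to `0` adds `c ≥ ε` to the expectation of `w`, which never exceeds
`1`, so at most `c⁻¹` visits are expected. -/
theorem tsum_pow_kernel_singleton_zero_ne_top {ε : ℝ≥0∞} (hε : 0 < ε)
    (hesc : ∀ x, ε ≤ M.escapeProb x) : ∑' n : ℕ, (M.kernel ^ (n + 1)) 0 {0} ≠ ∞ := by
  set w := ({0}ᶜ : Set ℝ≥0).indicator M.escapeProb with hw
  have hwm : Measurable w := M.measurable_escapeProb.indicator (measurableSet_singleton 0).compl
  have hw1 : ∀ x, w x ≤ 1 := fun x =>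
    (indicator_le_self' (fun _ _ => zero_le) x).trans (M.escapeProb_le_one x)
  set c := ∫⁻ y, w y ∂(M.kernel 0) with hc
  have hcε : ε ≤ c := by
    calc ε = ∫⁻ y in {0}ᶜ, ε ∂(M.kernel 0) := by
          rw [setLIntegral_const, (prob_compl_eq_one_iff (measurableSet_singleton 0)).2
            M.kernel_zero_singleton_zero, mul_one]
      _ ≤ ∫⁻ y in {0}ᶜ, M.escapeProb y ∂(M.kernel 0) := lintegral_mono hesc
      _ = c := (lintegral_indicator (measurableSet_singleton 0).compl _).symm
  have hc0 : c ≠ 0 := (hε.trans_le hcε).ne'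
  have hiter : ∀ n : ℕ, c * ∑ k ∈ Finset.range n, (M.kernel ^ k) 0 {0}
      ≤ ∫⁻ y, w y ∂(M.kernel ^ n) 0 := by
    intro n
    induction n with
    | zero => simp
    | succ n ih =>
      rw [lintegral_pow_succ _ _ _ hwm, Finset.sum_range_succ, mul_add]
      calc _ ≤ ∫⁻ y, w y ∂(M.kernel ^ n) 0 + c * (M.kernel ^ n) 0 {0} := by gcongr
        _ = ∫⁻ y, (w y + c * ({0} : Set ℝ≥0).indicator 1 y) ∂(M.kernel ^ n) 0 := by
            rw [lintegral_add_left hwm, lintegral_const_mul _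
              (measurable_one.indicator (measurableSet_singleton 0)),
              lintegral_indicator_one (measurableSet_singleton 0)]
        _ ≤ _ := lintegral_mono M.escapeProb_add_le
  have hbound : ∀ n : ℕ, ∑ k ∈ Finset.range n, (M.kernel ^ (k + 1)) 0 {0} ≤ c⁻¹ := by
    intro n
    rw [ENNReal.le_inv_iff_mul_le, mul_comm]
    calc c * ∑ k ∈ Finset.range n, (M.kernel ^ (k + 1)) 0 {0}
        ≤ c * ∑ k ∈ Finset.range (n + 1), (M.kernel ^ k) 0 {0} := by
          rw [Finset.sum_range_succ']
          gcongr
          exact le_self_add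
      _ ≤ ∫⁻ y, w y ∂(M.kernel ^ (n + 1)) 0 := hiter _
      _ ≤ ∫⁻ y, 1 ∂(M.kernel ^ (n + 1)) 0 := lintegral_mono hw1
      _ = 1 := by simp [pow_apply_univ]
  rw [ENNReal.tsum_eq_iSup_nat]
  exact ne_top_of_le_ne_top (ENNReal.inv_ne_top.2 hc0) (iSup_le hbound)

/-- All factors are at least `1`, so the product of suprema over any block of indices is at most a
product starting at index `0`; this makes `C` uniform in `x`. -/
theorem exists_prod_ratio_le {N : ℕ} {L : ℝ}
    (h : Tendsto (fun n : ℕ => ∏ m ∈ Finset.Ico N n, M.supRatio m) atTop (𝓝 L)) :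
    ∃ C : ℝ, ∀ (x : ℝ≥0) (n : ℕ), ∏ k ∈ Finset.range n, M.ratio (x + k) ≤ C := by
  have hpos : ∀ m, 0 < M.supRatio m := fun m => one_pos.trans_le (M.one_le_supRatio m)
  have hsub : ∀ s t : Finset ℕ, s ⊆ t → ∏ m ∈ s, M.supRatio m ≤ ∏ m ∈ t, M.supRatio m :=
    fun s t hst => Finset.prod_le_prod_of_subset_of_one_le hst (fun m _ => (hpos m).le)
      fun m _ _ => M.one_le_supRatio m
  obtain ⟨K, hK⟩ := h.bddAbove_range
  -- `K` bounds the partial products from `N` on; the first `N` factors, which the hypothesis does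
  -- not see, are put in by hand.
  refine ⟨(∏ m ∈ Finset.range N, M.supRatio m) * K, fun x n => ?_⟩
  have hP : ∀ n : ℕ, 0 < ∏ m ∈ Finset.range n, M.supRatio m := fun n =>
    Finset.prod_pos fun m _ => hpos m
  calc ∏ k ∈ Finset.range n, M.ratio (x + k)
      ≤ ∏ k ∈ Finset.range n, M.supRatio (⌊x⌋₊ + k) :=
        Finset.prod_le_prod (fun k _ => (M.ratio_pos _).le) fun k _ => M.le_supRatio x k
    _ ≤ (∏ m ∈ Finset.range ⌊x⌋₊, M.supRatio m) *
          ∏ k ∈ Finset.range n, M.supRatio (⌊x⌋₊ + k) :=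
        le_mul_of_one_le_left (Finset.prod_nonneg fun k _ => (hpos _).le)
          (by simpa using hsub ∅ (Finset.range ⌊x⌋₊) (Finset.empty_subset _))
    _ = ∏ m ∈ Finset.range (⌊x⌋₊ + n), M.supRatio m := (Finset.prod_range_add _ _ _).symm
    _ ≤ ∏ m ∈ Finset.range (N + (⌊x⌋₊ + n)), M.supRatio m :=
        hsub _ _ (Finset.range_subset_range.2 (by omega))
    _ = (∏ m ∈ Finset.range N, M.supRatio m) *
          ∏ m ∈ Finset.Ico N (N + (⌊x⌋₊ + n)), M.supRatio m :=
        (Finset.prod_range_mul_prod_Ico _ (by omega)).symm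
    _ ≤ _ := by
        gcongr
        · exact (hP N).le
        · exact hK (mem_range_self _)

theorem isTransient_of_prod_ratio_le {C : ℝ}
    (hC : ∀ (x : ℝ≥0) (n : ℕ), ∏ k ∈ Finset.range n, M.ratio (x + k) ≤ C) :
    IsTransient M.kernel := by
  obtain ⟨ψ, hψ, h0⟩ := M.exists_maximal_charging_zero
  refine ⟨⟨ψ, hψ⟩, fun hrec => ?_⟩
  have hC0 : 0 < C := one_pos.trans_le (by simpa using hC 0 0)
  refine M.tsum_pow_kernel_singleton_zero_ne_top (ε := ENNReal.ofReal C⁻¹) (by simpa using hC0)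
    (fun x => le_iInf fun n => ?_) (hrec.2 ψ hψ 0 {0} ⟨measurableSet_singleton 0, h0⟩)
  rw [← ENNReal.ofReal_prod_of_nonneg fun k _ => inv_nonneg.2 (M.ratio_pos _).le,
    Finset.prod_inv_distrib]
  exact ENNReal.ofReal_le_ofReal
    (inv_anti₀ (Finset.prod_pos fun k _ => M.ratio_pos _) (hC x n))

end ImmigrationChain

theorem proposition4 (M : ImmigrationChain) :
    ((∃ x₁ : ℝ≥0, 0 < x₁ ∧ (∀ x, x₁ ≤ x → 0 < M.b x) ∧
        Tendsto (fun n : ℕ => ∏ m ∈ Finset.Ico ⌊x₁⌋₊ n, M.infRatio m) atTop atTop) →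
      MarkovChain.IsHarrisRecurrent M.kernel ∧ MarkovChain.IsRecurrent M.kernel) ∧
    ((∃ x₁ : ℝ≥0, 0 < x₁ ∧ (∀ x, x₁ ≤ x → 0 < M.b x) ∧
        ∃ L : ℝ, Tendsto (fun n : ℕ => ∏ m ∈ Finset.Ico ⌊x₁⌋₊ n, M.supRatio m) atTop (𝓝 L)) →
      MarkovChain.IsTransient M.kernel) := by
  constructor
  · rintro ⟨x₁, -, -, h⟩
    have hH := M.isHarrisRecurrent_of_tendsto (M.tendsto_prod_ratio h)
    exact ⟨hH, hH.isRecurrent⟩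
  · rintro ⟨x₁, -, -, L, h⟩
    obtain ⟨C, hC⟩ := M.exists_prod_ratio_le h
    exact M.isTransient_of_prod_ratio_le hC
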